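/- Let $k$ be a field of characteristic $0$ and let $G$, $T$ be finite abelian groups. For finite groups $H, K$, let $kB_T(H\times K)=k\otimes_{\mathbb Z} B(H\times K\times T)$, where $B(\Gamma)$ is the Grothendieck group of finite $\Gamma$-sets with respect to disjoint union. For a finite $(H\times K\times T)$-set $X$ and a finite $(K\times L\times T)$-set $Y$, let $X\times_K^d Y$ be the quotient of $X\times Y$ by the relation $((1,x,1)u,(x,1,1)v)\sim(u,v)$ for $x\in K$, with the action $(h,l,t)[u,v]=[(h,1,t)u,(1,l,t)v]$ of $H\times L\times T$, and extend $\times_K^d$ to a $k$-bilinear map $kB_T(H\times K)\times kB_T(K\times L)\to kB_T(H\times L)$. The essential algebra $\widehat{kB_T}(G)$ is the quotient of the $k$-algebra $(kB_T(G\times G),\times_G^d)$ by the two-sided ideal generated by all $a\times_K^d b$ with $a\in kB_T(G\times K)$, $b\in kB_T(K\times G)$ and $K$ a group with $|K|<|G|$. For subgroups $D\leqslant H\times K\times T$ and $E\leqslant K\times L\times T$ let $$D\ast E=\{(h,l,t)\mid \exists x\in K:\ (h,x,t)\in D,\ (x,l,t)\in E\},\qquad \kappa(D,E)=\frac{|\{x\in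 K\mid (1,x,1)\in D,\ (x,1,1)\in E\}|}{|K|}.$$ Let $k\mathscr S_{HKT}$ be the $k$-vector space with basis the set of subgroups of $H\times K\times T$, and let $\ast_K^\kappa$ be the $k$-bilinear map $k\mathscr S_{HKT}\times k\mathscr S_{KLT}\to k\mathscr S_{HLT}$ with $D\ast_K^\kappa E=\kappa(D,E)\,D\ast E$. The essential star algebra $\widehat{k\mathscr S}_{GGT}$ is the quotient of the $k$-algebra $(k\mathscr S_{GGT},\ast_G^\kappa)$ by the two-sided ideal generated by all $a\ast_K^\kappa b$ with $a\in k\mathscr S_{GKT}$, $b\in k\mathscr S_{KGT}$ and $K$ a group with $|K|<|G|$. Let $\alpha_{GGT}:kB_T(G\times G)\to k\mathscr S_{GGT}$ be the $k$-linear map with $\alpha_{GGT}([X])=\sum_{x\in X}\mathrm{Stab}_{G\times G\times T}(x)$ for every finite $(G\times G\times T)$-set $X$. Let $\mathcal L_{s'}\subseteq\widehat{kB_T}(G)$ be the set of the images of the classes $[(G\times G\times T)/D]$, where $D$ runs over the subgroups of $G\times G\times T$ that cannot be written as $D=E\ast F$ with $E\leqslant G\times H\times T$, $F\leqslant H\times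 G\times T$ and $H$ a group with $|H|<|G|$. Then $\mathcal L_{s'}$ is a $k$-basis of $\widehat{kB_T}(G)$. Moreover, $\alpha_{GGT}$ induces a well-defined map $\widehat\alpha_{GGT}:\widehat{kB_T}(G)\to\widehat{k\mathscr S}_{GGT}$ on the quotients, and $\widehat\alpha_{GGT}$ is an isomorphism of (unital) $k$-algebras. -/

import Mathlib

universe u v

namespace ShiftedBurnside

/-! ### Finite `Γ`-sets and the Burnside module `kB(Γ)` -/

/-- A finite (left) `Γ`-set. -/
structure FinGSet (Γ : Type u) [Group Γ] : Type (u + 1) where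
  /-- the underlying set -/
  carrier : Type u
  /-- the action of `Γ` -/
  [action : MulAction Γ carrier]
  /-- the underlying set is finite -/
  [fin : Finite carrier]

attribute [instance] FinGSet.action FinGSet.fin

section Burnside

variable {Γ : Type u} [Group Γ]

/-- Two finite `Γ`-sets are isomorphic: there is a `Γ`-equivariant bijection between them. -/
def FinGSet.Iso (X Y : FinGSet Γ) : Prop :=
  ∃ e : X.carrier ≃ Y.carrier, ∀ (g : Γ) (x : X.carrier), e (g • x) = g • e x

/-- The disjoint union of two finite `Γ`-sets. -/
def FinGSet.disjUnion (X Y : FinGSet Γ) : FinGSet Γ :=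
  letI : MulAction Γ (X.carrier ⊕ Y.carrier) :=
    { smul := fun g => Sum.map (g • ·) (g • ·)
      one_smul := by
        rintro (x | y)
        · exact congrArg Sum.inl (one_smul Γ x)
        · exact congrArg Sum.inr (one_smul Γ y)
      mul_smul := by
        rintro g h (x | y)
        · exact congrArg Sum.inl (mul_smul g h x)
        · exact congrArg Sum.inr (mul_smul g h y) }
  ⟨X.carrier ⊕ Y.carrier⟩

/-- The empty `Γ`-set. -/
def FinGSet.empty (Γ : Type u) [Group Γ] : FinGSet Γ :=
  letI : MulAction Γ PEmpty.{u + 1} :=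
    { smul := fun _ => PEmpty.elim
      one_smul := fun x => x.elim
      mul_smul := fun _ _ x => x.elim }
  ⟨PEmpty⟩

/-- The transitive `Γ`-set `Γ / D`. -/
def FinGSet.coset [Finite Γ] (D : Subgroup Γ) : FinGSet Γ := ⟨Γ ⧸ D⟩

variable (k : Type v) [CommRing k]

/-- The relations `[X] = [Y]` for `X ≅ Y` and `[X ⊔ Y] = [X] + [Y]`. -/
def burnsideRel (Γ : Type u) [Group Γ] : Set (FinGSet Γ →₀ k) :=
  {z | ∃ X Y : FinGSet Γ, X.Iso Y ∧ z = Finsupp.single X 1 - Finsupp.single Y 1} ∪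
  {z | ∃ X Y : FinGSet Γ, z =
    Finsupp.single (X.disjUnion Y) 1 - (Finsupp.single X 1 + Finsupp.single Y 1)}

/-- The Burnside module `kB(Γ) = k ⊗ B(Γ)`: the Grothendieck group, with coefficients in `k`,
of the isomorphism classes of finite `Γ`-sets with respect to disjoint union. -/
def Burnside (Γ : Type u) [Group Γ] : Type (max (u + 1) v) :=
  (FinGSet Γ →₀ k) ⧸ Submodule.span k (burnsideRel k Γ)

noncomputable instance : AddCommGroup (Burnside k Γ) :=
  inferInstanceAs (AddCommGroup ((FinGSet Γ →₀ k) ⧸ Submodule.span k (burnsideRel k Γ)))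

noncomputable instance : Module k (Burnside k Γ) :=
  inferInstanceAs (Module k ((FinGSet Γ →₀ k) ⧸ Submodule.span k (burnsideRel k Γ)))

/-- The class `[X]` of a finite `Γ`-set in `kB(Γ)`. -/
noncomputable def cls (X : FinGSet Γ) : Burnside k Γ :=
  (Submodule.span k (burnsideRel k Γ)).mkQ (Finsupp.single X 1)

theorem cls_iso {X Y : FinGSet Γ} (h : X.Iso Y) : cls k X = cls k Y :=
  (Submodule.Quotient.eq _).2 (Submodule.subset_span (Or.inl ⟨X, Y, h, rfl⟩))

theorem cls_disjUnion (X Y : FinGSet Γ) : cls k (X.disjUnion Y) = cls k X + cls k Y :=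
  (Submodule.Quotient.eq _).2 (Submodule.subset_span (Or.inr ⟨X, Y, rfl⟩))

/-- The universal property of `kB(Γ)`. -/
noncomputable def Burnside.lift {M : Type*} [AddCommGroup M] [Module k M] (f : FinGSet Γ → M)
    (hiso : ∀ X Y : FinGSet Γ, X.Iso Y → f X = f Y)
    (hadd : ∀ X Y : FinGSet Γ, f (X.disjUnion Y) = f X + f Y) : Burnside k Γ →ₗ[k] M :=
  (Submodule.span k (burnsideRel k Γ)).liftQ (Finsupp.linearCombination k f) <| by
    rw [Submodule.span_le]
    rintro z (⟨X, Y, h, rfl⟩ | ⟨X, Y, rfl⟩)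
    · simp [hiso X Y h]
    · simp [hadd X Y]

@[simp]
theorem Burnside.lift_cls {M : Type*} [AddCommGroup M] [Module k M] (f : FinGSet Γ → M)
    (hiso : ∀ X Y : FinGSet Γ, X.Iso Y → f X = f Y)
    (hadd : ∀ X Y : FinGSet Γ, f (X.disjUnion Y) = f X + f Y) (X : FinGSet Γ) :
    Burnside.lift k f hiso hadd (cls k X) = f X := by
  change (Submodule.span k (burnsideRel k Γ)).liftQ _ _ (Submodule.mkQ _ _) = _
  simp

theorem Burnside.hom_ext {M : Type*} [AddCommGroup M] [Module k M] {f g : Burnside k Γ →ₗ[k] M}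
    (h : ∀ X : FinGSet Γ, f (cls k X) = g (cls k X)) : f = g := by
  refine Submodule.linearMap_qext _ (Finsupp.lhom_ext' fun X => LinearMap.ext_ring ?_)
  exact h X

end Burnside

/-! ### The product `X ×_H^d Y` -/

section Comp

variable {G H K L T : Type u} [Group G] [Group H] [Group K] [Group L] [Group T]

/-- The equivalence relation on `X × Y` whose quotient is `X ×_H Y`: here `X` is regarded as a
right `H`-set through `x h = (1, h⁻¹, 1) x`, so that `(x h, y) ∼ (x, h y)` says that `(x, y)` is
identified with `(x h⁻¹, h y)`. -/
def tensorSetoid (X : FinGSet (G × H × T)) (Y : FinGSet (H × K × T)) :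
    Setoid (X.carrier × Y.carrier) where
  r p q := ∃ h : H, q.1 = ((1, h, 1) : G × H × T) • p.1 ∧ q.2 = ((h, 1, 1) : H × K × T) • p.2
  iseqv :=
    { refl := fun p => ⟨1, (one_smul (G × H × T) p.1).symm, (one_smul (H × K × T) p.2).symm⟩
      symm := by
        rintro ⟨x, y⟩ ⟨x', y'⟩ ⟨h, h1, h2⟩
        simp only at h1 h2
        refine ⟨h⁻¹, ?_, ?_⟩
        · simp [h1, smul_smul, ← Prod.one_eq_mk]
        · simp [h2, smul_smul, ← Prod.one_eq_mk]
      trans := by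
        rintro ⟨x, y⟩ ⟨x', y'⟩ ⟨x'', y''⟩ ⟨h, h1, h2⟩ ⟨h', h1', h2'⟩
        simp only at h1 h2 h1' h2'
        refine ⟨h' * h, ?_, ?_⟩
        · simp [h1, h1', smul_smul]
        · simp [h2, h2', smul_smul] }

/-- The `(G × K × T)`-set `X ×_H^d Y`: the set `X ×_H Y` with the action
`(g, k, t) [x, y] = [(g, 1, t) x, (1, k, t) y]`, in particular with the diagonal action of `T`. -/
def FinGSet.tensor (X : FinGSet (G × H × T)) (Y : FinGSet (H × K × T)) : FinGSet (G × K × T) :=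
  letI : MulAction (G × K × T) (Quotient (tensorSetoid X Y)) :=
    { smul := fun a => Quotient.map
        (fun p => (((a.1, 1, a.2.2) : G × H × T) • p.1, ((1, a.2.1, a.2.2) : H × K × T) • p.2))
        (by
          obtain ⟨a1, a2, t⟩ := a
          rintro ⟨x, y⟩ ⟨x', y'⟩ ⟨h, h1, h2⟩
          simp only at h1 h2
          refine ⟨h, ?_, ?_⟩
          · simp [h1, smul_smul]
          · simp [h2, smul_smul])
      one_smul := by
        rintro ⟨x, y⟩
        exact congrArg (Quotient.mk _)
          (Prod.ext (one_smul (G × H × T) x) (one_smul (H × K × T) y))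
      mul_smul := by
        rintro ⟨a1, a2, t⟩ ⟨b1, b2, s⟩ ⟨x, y⟩
        refine congrArg (Quotient.mk _) (Prod.ext ?_ ?_)
        · simp [smul_smul]
        · simp [smul_smul] }
  ⟨Quotient (tensorSetoid X Y)⟩

/-- The element `[x, y]` of `X ×_H^d Y`. -/
def tmk {X : FinGSet (G × H × T)} {Y : FinGSet (H × K × T)} (x : X.carrier) (y : Y.carrier) :
    (X.tensor Y).carrier :=
  Quotient.mk (tensorSetoid X Y) (x, y)

theorem smul_tmk {X : FinGSet (G × H × T)} {Y : FinGSet (H × K × T)} (a : G × K × T)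
    (x : X.carrier) (y : Y.carrier) :
    a • (tmk x y : (X.tensor Y).carrier) =
      tmk (((a.1, 1, a.2.2) : G × H × T) • x) (((1, a.2.1, a.2.2) : H × K × T) • y) := rfl

theorem tmk_ind {X : FinGSet (G × H × T)} {Y : FinGSet (H × K × T)}
    {P : (X.tensor Y).carrier → Prop} (h : ∀ x y, P (tmk x y)) (z) : P z :=
  Quotient.inductionOn z fun p => h p.1 p.2

theorem tmk_eq_iff {X : FinGSet (G × H × T)} {Y : FinGSet (H × K × T)} {x x' : X.carrier}
    {y y' : Y.carrier} :
    (tmk x y : (X.tensor Y).carrier) = tmk x' y' ↔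
      ∃ h : H, x' = ((1, h, 1) : G × H × T) • x ∧ y' = ((h, 1, 1) : H × K × T) • y :=
  Quotient.eq (r := tensorSetoid X Y)

/-- A map out of `X ×_H^d Y`. -/
def tlift {X : FinGSet (G × H × T)} {Y : FinGSet (H × K × T)} {Z : Type*}
    (f : X.carrier → Y.carrier → Z)
    (hf : ∀ (h : H) x y, f (((1, h, 1) : G × H × T) • x) (((h, 1, 1) : H × K × T) • y) = f x y) :
    (X.tensor Y).carrier → Z :=
  Quotient.lift (fun p => f p.1 p.2) (by
    rintro ⟨x, y⟩ ⟨x', y'⟩ ⟨h, h1, h2⟩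
    simp only at h1 h2
    rw [h1, h2]
    exact (hf h x y).symm)

theorem tensor_iso {X X' : FinGSet (G × H × T)} {Y Y' : FinGSet (H × K × T)}
    (hX : X.Iso X') (hY : Y.Iso Y') : (X.tensor Y).Iso (X'.tensor Y') := by
  obtain ⟨e, he⟩ := hX
  obtain ⟨f, hf⟩ := hY
  refine ⟨Quotient.congr (e.prodCongr f) ?_, ?_⟩
  · rintro ⟨x, y⟩ ⟨x', y'⟩
    change (∃ h : H, _ ∧ _) ↔ (∃ h : H, _ ∧ _)
    refine exists_congr fun h => ?_
    simp [← he, ← hf]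
  · rintro a ⟨x, y⟩
    refine congrArg (Quotient.mk _) (Prod.ext ?_ ?_)
    · exact he _ _
    · exact hf _ _

theorem tensor_disjUnion_left (X X' : FinGSet (G × H × T)) (Y : FinGSet (H × K × T)) :
    ((X.disjUnion X').tensor Y).Iso ((X.tensor Y).disjUnion (X'.tensor Y)) := by
  refine ⟨⟨tlift (fun z y => Sum.map (fun x => tmk x y) (fun x => tmk x y) z) ?_,
    Sum.elim (tlift (fun x y => tmk (X := X.disjUnion X') (Sum.inl x) y) ?_)
      (tlift (fun x y => tmk (X := X.disjUnion X') (Sum.inr x) y) ?_), ?_, ?_⟩, ?_⟩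
  · rintro h (x | x) y
    · exact congrArg Sum.inl (tmk_eq_iff.2 ⟨h, rfl, rfl⟩).symm
    · exact congrArg Sum.inr (tmk_eq_iff.2 ⟨h, rfl, rfl⟩).symm
  · exact fun h x y =>
      (tmk_eq_iff (X := X.disjUnion X') (x := Sum.inl x)).2 ⟨h, rfl, rfl⟩ |>.symm
  · exact fun h x y =>
      (tmk_eq_iff (X := X.disjUnion X') (x := Sum.inr x)).2 ⟨h, rfl, rfl⟩ |>.symm
  · refine tmk_ind ?_
    rintro (x | x) y <;> rfl
  · rintro (z | z)
    · revert z; exact tmk_ind fun x y => rfl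
    · revert z; exact tmk_ind fun x y => rfl
  · intro a
    refine tmk_ind ?_
    rintro (x | x) y <;> rfl

theorem tensor_disjUnion_right (X : FinGSet (G × H × T)) (Y Y' : FinGSet (H × K × T)) :
    (X.tensor (Y.disjUnion Y')).Iso ((X.tensor Y).disjUnion (X.tensor Y')) := by
  refine ⟨⟨tlift (fun x z => Sum.map (fun y => tmk x y) (fun y => tmk x y) z) ?_,
    Sum.elim (tlift (fun x y => tmk (Y := Y.disjUnion Y') x (Sum.inl y)) ?_)
      (tlift (fun x y => tmk (Y := Y.disjUnion Y') x (Sum.inr y)) ?_), ?_, ?_⟩, ?_⟩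
  · rintro h x (y | y)
    · exact congrArg Sum.inl (tmk_eq_iff.2 ⟨h, rfl, rfl⟩).symm
    · exact congrArg Sum.inr (tmk_eq_iff.2 ⟨h, rfl, rfl⟩).symm
  · exact fun h x y =>
      (tmk_eq_iff (Y := Y.disjUnion Y') (y := Sum.inl y)).2 ⟨h, rfl, rfl⟩ |>.symm
  · exact fun h x y =>
      (tmk_eq_iff (Y := Y.disjUnion Y') (y := Sum.inr y)).2 ⟨h, rfl, rfl⟩ |>.symm
  · refine tmk_ind ?_
    rintro x (y | y) <;> rfl
  · rintro (z | z)
    · revert z; exact tmk_ind fun x y => rfl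
    · revert z; exact tmk_ind fun x y => rfl
  · intro a
    refine tmk_ind ?_
    rintro x (y | y) <;> rfl

theorem tensor_assoc (X : FinGSet (G × H × T)) (Y : FinGSet (H × K × T))
    (Z : FinGSet (K × L × T)) :
    ((X.tensor Y).tensor Z).Iso (X.tensor (Y.tensor Z)) := by
  refine ⟨⟨tlift (fun w z => tlift (fun x y => tmk x (tmk y z)) ?_ w) ?_,
    tlift (fun x w => tlift (fun y z => tmk (tmk x y) z) ?_ w) ?_, ?_, ?_⟩, ?_⟩
  · intro h x y
    refine (tmk_eq_iff.2 ⟨h, rfl, ?_⟩).symm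
    rw [smul_tmk]
    exact congrArg _ (one_smul (K × L × T) z).symm
  · intro l
    refine tmk_ind fun x y => ?_
    intro z
    change tmk (((1, 1, 1) : G × H × T) • x) (tmk (((1, l, 1) : H × K × T) • y) _) = tmk x (tmk y z)
    rw [show (((1, 1, 1) : G × H × T) • x) = x from one_smul (G × H × T) x]
    exact congrArg _ (tmk_eq_iff.2 ⟨l, rfl, rfl⟩).symm
  · intro l y z
    refine (tmk_eq_iff.2 ⟨l, ?_, rfl⟩).symm
    rw [smul_tmk]
    exact congrArg (fun x' => tmk x' _) (one_smul (G × H × T) x).symm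
  · intro h x
    refine tmk_ind fun y z => ?_
    change tmk (tmk _ (((h, 1, 1) : H × K × T) • y)) (((1, 1, 1) : K × L × T) • z) = tmk (tmk x y) z
    rw [show (((1, 1, 1) : K × L × T) • z) = z from one_smul (K × L × T) z]
    exact congrArg (fun w => tmk w z) (tmk_eq_iff.2 ⟨h, rfl, rfl⟩).symm
  · refine tmk_ind fun w z => ?_
    revert w
    exact tmk_ind fun x y => rfl
  · refine tmk_ind fun x w => ?_
    revert w
    exact tmk_ind fun y z => rfl
  · intro a
    refine tmk_ind fun w z => ?_
    revert w
    exact tmk_ind fun x y => rfl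

/-- The identity `(G, G)`-biset `G` with trivial action of `T`, that is `(a, b, t) g = a g b⁻¹`;
it is isomorphic to `(G × G × T) / (Δ(G) × T)`. -/
def FinGSet.unit (G T : Type u) [Group G] [Group T] [Finite G] : FinGSet (G × G × T) :=
  letI : MulAction (G × G × T) G :=
    { smul := fun a g => a.1 * g * a.2.1⁻¹
      one_smul := fun g => by change 1 * g * 1⁻¹ = g; simp
      mul_smul := fun a b g => by
        change a.1 * b.1 * g * (a.2.1 * b.2.1)⁻¹ = a.1 * (b.1 * g * b.2.1⁻¹) * a.2.1⁻¹
        simp [mul_assoc] }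
  ⟨G⟩

theorem unit_tensor [Finite G] (X : FinGSet (G × H × T)) :
    ((FinGSet.unit G T).tensor X).Iso X := by
  refine ⟨⟨tlift (fun (g : G) x => ((g, 1, 1) : G × H × T) • x) ?_,
    fun x => tmk (X := FinGSet.unit G T) (1 : G) x, ?_, ?_⟩, ?_⟩
  · intro h (g : G) x
    change ((1 * g * h⁻¹, 1, 1) : G × H × T) • _ = _
    simp [smul_smul]
  · refine tmk_ind fun (g : G) x => ?_
    refine (tmk_eq_iff.2 ⟨(g : G), ?_, rfl⟩).symm
    change (1 : G) = 1 * g * g⁻¹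
    simp
  · exact fun x => one_smul (G × H × T) x
  · intro a
    refine tmk_ind fun (g : G) x => ?_
    change ((a.1 * g * 1⁻¹, 1, 1) : G × H × T) • ((1, a.2.1, a.2.2) : G × H × T) • x =
      a • ((g, 1, 1) : G × H × T) • x
    obtain ⟨a, b, t⟩ := a
    simp [smul_smul]

theorem tensor_unit [Finite H] (X : FinGSet (G × H × T)) :
    (X.tensor (FinGSet.unit H T)).Iso X := by
  refine ⟨⟨tlift (fun x (g : H) => ((1, g⁻¹, 1) : G × H × T) • x) ?_,
    fun x => tmk (Y := FinGSet.unit H T) x (1 : H), ?_, ?_⟩, ?_⟩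
  · intro h x (g : H)
    change ((1, (h * g * 1⁻¹)⁻¹, 1) : G × H × T) • _ = _
    simp [smul_smul]
  · refine tmk_ind fun x (g : H) => ?_
    refine (tmk_eq_iff.2 ⟨(g⁻¹ : H), rfl, ?_⟩).symm
    change (1 : H) = g⁻¹ * g * 1⁻¹
    simp
  · intro x
    change ((1, 1⁻¹, 1) : G × H × T) • x = x
    rw [inv_one]
    exact one_smul (G × H × T) x
  · intro a
    refine tmk_ind fun x (g : H) => ?_
    change ((1, (1 * g * a.2.1⁻¹)⁻¹, 1) : G × H × T) • ((a.1, 1, a.2.2) : G × H × T) • x =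
      a • ((1, g⁻¹, 1) : G × H × T) • x
    obtain ⟨a, b, t⟩ := a
    simp [smul_smul]

variable (k : Type v) [CommRing k]

/-- The `k`-bilinear map `×_H^d : kB_T(G × H) × kB_T(H × K) → kB_T(G × K)`,
`([X], [Y]) ↦ [X ×_H^d Y]`, where `kB_T(G × H) = kB(G × H × T)`. -/
noncomputable def burnsideComp :
    Burnside k (G × H × T) →ₗ[k] Burnside k (H × K × T) →ₗ[k] Burnside k (G × K × T) :=
  Burnside.lift k
    (fun X => Burnside.lift k (fun Y => cls k (X.tensor Y))
      (fun _ _ h => cls_iso k (tensor_iso ⟨Equiv.refl _, fun _ _ => rfl⟩ h))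
      (fun Y Y' => (cls_iso k (tensor_disjUnion_right X Y Y')).trans (cls_disjUnion k _ _)))
    (fun X X' h => Burnside.hom_ext k fun Y => by
      simpa using cls_iso k (tensor_iso h ⟨Equiv.refl _, fun _ _ => rfl⟩))
    (fun X X' => Burnside.hom_ext k fun Y => by
      simpa using (cls_iso k (tensor_disjUnion_left X X' Y)).trans (cls_disjUnion k _ _))

@[simp]
theorem burnsideComp_cls (X : FinGSet (G × H × T)) (Y : FinGSet (H × K × T)) :
    burnsideComp k (cls k X) (cls k Y) = cls k (X.tensor Y) := by
  simp [burnsideComp]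

theorem Burnside.induction {Γ : Type u} [Group Γ] {P : Burnside k Γ → Prop}
    (hcls : ∀ X, P (cls k X)) (hadd : ∀ a b, P a → P b → P (a + b))
    (hsmul : ∀ (c : k) a, P a → P (c • a)) (a : Burnside k Γ) : P a := by
  have h0 : ∀ z : FinGSet Γ →₀ k, P ((Submodule.span k (burnsideRel k Γ)).mkQ z) := by
    intro z
    induction z using Finsupp.induction_linear with
    | zero =>
      have := hsmul 0 _ (hcls (FinGSet.empty Γ))
      rw [zero_smul] at this
      rw [map_zero]
      exact this
    | add f g hf hg => rw [map_add]; exact hadd _ _ hf hg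
    | single X c =>
      have h1 : Finsupp.single X c = c • Finsupp.single X (1 : k) := by simp
      rw [h1, map_smul]
      exact hsmul c _ (hcls X)
  obtain ⟨z, rfl⟩ := Submodule.mkQ_surjective _ a
  exact h0 z

theorem burnsideComp_assoc (a : Burnside k (G × H × T)) (b : Burnside k (H × K × T))
    (c : Burnside k (K × L × T)) :
    burnsideComp k (burnsideComp k a b) c = burnsideComp k a (burnsideComp k b c) := by
  induction a using Burnside.induction with
  | hadd a a' h h' => simp only [map_add, LinearMap.add_apply, h, h']
  | hsmul r a h => simp only [map_smul, LinearMap.smul_apply, h]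
  | hcls X =>
  induction b using Burnside.induction with
  | hadd a a' h h' => simp only [map_add, LinearMap.add_apply, h, h']
  | hsmul r a h => simp only [map_smul, LinearMap.smul_apply, h]
  | hcls Y =>
  induction c using Burnside.induction with
  | hadd a a' h h' => simp only [map_add, h, h']
  | hsmul r a h => simp only [map_smul, h]
  | hcls Z =>
  simpa using cls_iso k (tensor_assoc X Y Z)

theorem unit_burnsideComp [Finite G] (a : Burnside k (G × H × T)) :
    burnsideComp k (cls k (FinGSet.unit G T)) a = a := by
  induction a using Burnside.induction with
  | hadd a a' h h' => simp only [map_add, h, h']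
  | hsmul r a h => simp only [map_smul, h]
  | hcls X => simpa using cls_iso k (unit_tensor X)

theorem burnsideComp_unit [Finite H] (a : Burnside k (G × H × T)) :
    burnsideComp k a (cls k (FinGSet.unit H T)) = a := by
  induction a using Burnside.induction with
  | hadd a a' h h' => simp only [map_add, LinearMap.add_apply, h, h']
  | hsmul r a h => simp only [map_smul, LinearMap.smul_apply, h]
  | hcls X => simpa using cls_iso k (tensor_unit X)

end Comp

/-! ### The algebra `kB_T(G × G)` and its essential algebra -/

section EssentialBurnside

variable (k : Type v) [CommRing k] (T G : Type u) [Group T] [Group G]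

/-- The `k`-module `kB_T(G × G) = kB(G × G × T)`, to be equipped with the product `×_G^d`. -/
def BurnsideEnd : Type (max (u + 1) v) := Burnside k (G × G × T)

noncomputable instance : AddCommGroup (BurnsideEnd k T G) :=
  inferInstanceAs (AddCommGroup (Burnside k (G × G × T)))

noncomputable instance : Module k (BurnsideEnd k T G) :=
  inferInstanceAs (Module k (Burnside k (G × G × T)))

/-- The ring `(kB_T(G × G), ×_G^d)`. -/
noncomputable instance [Finite G] : Ring (BurnsideEnd k T G) :=
  { (inferInstance : AddCommGroup (BurnsideEnd k T G)) with
    mul := fun a b => burnsideComp k (G := G) (H := G) (K := G) (T := T) a b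
    one := cls k (FinGSet.unit G T)
    mul_assoc := burnsideComp_assoc k
    one_mul := unit_burnsideComp k
    mul_one := burnsideComp_unit k
    left_distrib := fun a => map_add (burnsideComp k (G := G) (H := G) (K := G) (T := T) a)
    right_distrib := LinearMap.map_add₂ (burnsideComp k (G := G) (H := G) (K := G) (T := T))
    zero_mul := LinearMap.map_zero₂ (burnsideComp k (G := G) (H := G) (K := G) (T := T))
    mul_zero := fun a => map_zero (burnsideComp k (G := G) (H := G) (K := G) (T := T) a) }

noncomputable instance [Finite G] : Algebra k (BurnsideEnd k T G) :=
  Algebra.ofModule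
    (fun c a b =>
      LinearMap.map_smul₂ (burnsideComp k (G := G) (H := G) (K := G) (T := T)) c a b)
    (fun c a b => map_smul (burnsideComp k (G := G) (H := G) (K := G) (T := T) a) c b)

/-- The two-sided ideal `I_T(G)` of `kB_T(G × G)` generated by the elements `a ×_K^d b` with
`a ∈ kB_T(G × K)`, `b ∈ kB_T(K × G)` and `K` a group with `|K| < |G|`. -/
noncomputable def burnsideIdeal [Finite G] : Ideal (BurnsideEnd k T G) :=
  (TwoSidedIdeal.span {z : BurnsideEnd k T G |
    ∃ (K : Type u) (_ : Group K) (_ : Finite K), Nat.card K < Nat.card G ∧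
      ∃ (a : Burnside k (G × K × T)) (b : Burnside k (K × G × T)),
        z = burnsideComp k a b}).asIdeal

instance [Finite G] : (burnsideIdeal k T G).IsTwoSided :=
  inferInstanceAs (TwoSidedIdeal.asIdeal _).IsTwoSided

/-- The essential algebra of `kB_T` at `G`. -/
abbrev EssentialBurnside [Finite G] : Type (max (u + 1) v) :=
  BurnsideEnd k T G ⧸ burnsideIdeal k T G

/-- The natural epimorphism `E_{T,G}` from `kB_T(G × G)` onto the essential algebra. -/
noncomputable def essentialMk [Finite G] : BurnsideEnd k T G →ₐ[k] EssentialBurnside k T G :=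
  Ideal.Quotient.mkₐ k (burnsideIdeal k T G)

end EssentialBurnside

/-! ### The star operation and the star algebra -/

section Star

variable {G H K L T : Type u} [Group G] [Group H] [Group K] [Group L] [Group T]

/-- The star product
`D ∗ E = {(g, k, t) | ∃ x, (g, x, t) ∈ D and (x, k, t) ∈ E}` of subgroups. -/
def starProd (D : Subgroup (G × H × T)) (E : Subgroup (H × K × T)) : Subgroup (G × K × T) where
  carrier := {a | ∃ x : H, (a.1, x, a.2.2) ∈ D ∧ (x, a.2.1, a.2.2) ∈ E}
  one_mem' := ⟨1, D.one_mem, E.one_mem⟩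
  mul_mem' := by
    rintro a b ⟨x, h1, h2⟩ ⟨y, h3, h4⟩
    exact ⟨x * y, D.mul_mem h1 h3, E.mul_mem h2 h4⟩
  inv_mem' := by
    rintro a ⟨x, h1, h2⟩
    exact ⟨x⁻¹, D.inv_mem h1, E.inv_mem h2⟩

/-- `k₁(E) = {h | (h, 1, 1) ∈ E}`. -/
def kOne (E : Subgroup (H × K × T)) : Subgroup H :=
  E.comap (MonoidHom.inl H (K × T))

/-- `k₂(D) = {h | (1, h, 1) ∈ D}`. -/
def kTwo (D : Subgroup (G × H × T)) : Subgroup H :=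
  D.comap ((MonoidHom.inr G (H × T)).comp (MonoidHom.inl H T))

theorem mem_kOne {E : Subgroup (H × K × T)} {h : H} : h ∈ kOne E ↔ (h, 1, 1) ∈ E := Iff.rfl

theorem mem_kTwo {D : Subgroup (G × H × T)} {h : H} : h ∈ kTwo D ↔ (1, h, 1) ∈ D := Iff.rfl

theorem mem_starProd {D : Subgroup (G × H × T)} {E : Subgroup (H × K × T)} {g : G} {l : K}
    {t : T} : (g, l, t) ∈ starProd D E ↔ ∃ x : H, (g, x, t) ∈ D ∧ (x, l, t) ∈ E := Iff.rfl

theorem starProd_assoc (D : Subgroup (G × H × T)) (E : Subgroup (H × K × T))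
    (F : Subgroup (K × L × T)) :
    starProd (starProd D E) F = starProd D (starProd E F) := by
  ext ⟨g, l, t⟩
  simp only [mem_starProd]
  constructor
  · rintro ⟨y, ⟨x, h1, h2⟩, h3⟩
    exact ⟨x, h1, y, h2, h3⟩
  · rintro ⟨x, h1, y, h2, h3⟩
    exact ⟨y, ⟨x, h1, h2⟩, h3⟩

/-- The subgroup `Δ(G) × T` of `G × G × T`. -/
def diagSubgroup (G T : Type u) [Group G] [Group T] : Subgroup (G × G × T) where
  carrier := {a | a.1 = a.2.1}
  one_mem' := rfl
  mul_mem' := fun {a b} (ha : a.1 = a.2.1) (hb : b.1 = b.2.1) =>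
    show a.1 * b.1 = a.2.1 * b.2.1 by rw [ha, hb]
  inv_mem' := fun {a} (ha : a.1 = a.2.1) => show a.1⁻¹ = a.2.1⁻¹ by rw [ha]

theorem mem_diagSubgroup {a b : G} {t : T} : (a, b, t) ∈ diagSubgroup G T ↔ a = b := Iff.rfl

theorem diag_starProd (D : Subgroup (G × H × T)) : starProd (diagSubgroup G T) D = D := by
  ext ⟨g, l, t⟩
  simp [mem_starProd, mem_diagSubgroup]

theorem starProd_diag (D : Subgroup (G × H × T)) : starProd D (diagSubgroup H T) = D := by
  ext ⟨g, l, t⟩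
  simp [mem_starProd, mem_diagSubgroup]

/-- For finite groups, `|k₂(D) ∩ k₁(E)| |k₂(D ∗ E) ∩ k₁(F)| = |k₂(D) ∩ k₁(E ∗ F)| |k₂(E) ∩ k₁(F)|`:
both sides count the `(x, y)` with `(1, x, 1) ∈ D`, `(x, y, 1) ∈ E`, `(y, 1, 1) ∈ F`. -/
theorem card_mul_card_star (D : Subgroup (G × H × T))
    (E : Subgroup (H × K × T)) (F : Subgroup (K × L × T)) :
    Nat.card ↥(kTwo D ⊓ kOne E) * Nat.card ↥(kTwo (starProd D E) ⊓ kOne F) =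
      Nat.card ↥(kTwo D ⊓ kOne (starProd E F)) * Nat.card ↥(kTwo E ⊓ kOne F) := by
  let S : Subgroup (H × K) :=
    { carrier := {p | (1, p.1, 1) ∈ D ∧ (p.1, p.2, 1) ∈ E ∧ (p.2, 1, 1) ∈ F}
      one_mem' := ⟨D.one_mem, E.one_mem, F.one_mem⟩
      mul_mem' := by
        rintro a b ⟨h1, h2, h3⟩ ⟨h4, h5, h6⟩
        refine ⟨?_, ?_, ?_⟩
        · simpa using D.mul_mem h1 h4
        · simpa using E.mul_mem h2 h5
        · simpa using F.mul_mem h3 h6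
      inv_mem' := by
        rintro a ⟨h1, h2, h3⟩
        refine ⟨?_, ?_, ?_⟩
        · simpa using D.inv_mem h1
        · simpa using E.inv_mem h2
        · simpa using F.inv_mem h3 }
  have key : ∀ {A B : Type u} [Group A] [Group B] (f : A →* B),
      Nat.card f.ker * Nat.card f.range = Nat.card A := by
    intro A B _ _ f
    rw [← Subgroup.index_ker, Subgroup.card_mul_index]
  let f : S →* K := (MonoidHom.snd H K).comp S.subtype
  let g : S →* H := (MonoidHom.fst H K).comp S.subtype
  have hf : f.range = kTwo (starProd D E) ⊓ kOne F := by
    ext y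
    constructor
    · rintro ⟨⟨⟨x, y'⟩, h1, h2, h3⟩, rfl⟩
      exact ⟨⟨x, h1, h2⟩, h3⟩
    · rintro ⟨⟨x, h1, h2⟩, h3⟩
      exact ⟨⟨⟨x, y⟩, h1, h2, h3⟩, rfl⟩
  have hg : g.range = kTwo D ⊓ kOne (starProd E F) := by
    ext x
    constructor
    · rintro ⟨⟨⟨x', y⟩, h1, h2, h3⟩, rfl⟩
      exact ⟨h1, y, h2, h3⟩
    · rintro ⟨h1, y, h2, h3⟩
      exact ⟨⟨⟨x, y⟩, h1, h2, h3⟩, rfl⟩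
  have hfk : Nat.card f.ker = Nat.card ↥(kTwo D ⊓ kOne E) := by
    refine Nat.card_congr
      ⟨fun p => ⟨p.1.1.1, p.1.2.1, ?_⟩, fun x => ⟨⟨⟨x.1, 1⟩, x.2.1, x.2.2, F.one_mem⟩, rfl⟩, ?_, ?_⟩
    · have h : p.1.1.2 = 1 := p.2
      have h2 := p.1.2.2.1
      rw [h] at h2
      exact h2
    · rintro ⟨⟨⟨x, y⟩, hxy⟩, h⟩
      have h' : y = 1 := h
      subst h'
      rfl
    · rintro ⟨x, hx⟩
      rfl
  have hgk : Nat.card g.ker = Nat.card ↥(kTwo E ⊓ kOne F) := by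
    refine Nat.card_congr
      ⟨fun p => ⟨p.1.1.2, ?_, p.1.2.2.2⟩, fun y => ⟨⟨⟨1, y.1⟩, D.one_mem, y.2.1, y.2.2⟩, rfl⟩, ?_, ?_⟩
    · have h : p.1.1.1 = 1 := p.2
      have h2 := p.1.2.2.1
      rw [h] at h2
      exact h2
    · rintro ⟨⟨⟨x, y⟩, hxy⟩, h⟩
      have h' : x = 1 := h
      subst h'
      rfl
    · rintro ⟨y, hy⟩
      rfl
  rw [← hf, ← hg, ← hfk, ← hgk, key f, mul_comm, key g]

variable (k : Type v) [Field k]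

/-- `κ(D, E) = |k₂(D) ∩ k₁(E)| / |H|`. -/
noncomputable def kappa (D : Subgroup (G × H × T)) (E : Subgroup (H × K × T)) : k :=
  (Nat.card ↥(kTwo D ⊓ kOne E) : k) / (Nat.card H : k)

/-- The `k`-bilinear map `∗_H^κ` from `k𝒮_{GHT} × k𝒮_{HKT}` to `k𝒮_{GKT}` sending `(D, E)` to
`κ(D, E) (D ∗ E)`; here `k𝒮_{GHT}` is the `k`-vector space with basis the set of subgroups of
`G × H × T`. -/
noncomputable def starComp :
    (Subgroup (G × H × T) →₀ k) →ₗ[k] (Subgroup (H × K × T) →₀ k) →ₗ[k]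
      (Subgroup (G × K × T) →₀ k) :=
  Finsupp.linearCombination k fun D => Finsupp.linearCombination k fun E =>
    kappa k D E • Finsupp.single (starProd D E) 1

@[simp]
theorem starComp_single (D : Subgroup (G × H × T)) (E : Subgroup (H × K × T)) :
    starComp k (Finsupp.single D 1) (Finsupp.single E 1) =
      kappa k D E • Finsupp.single (starProd D E) 1 := by
  simp [starComp]

theorem kappa_cocycle (D : Subgroup (G × H × T)) (E : Subgroup (H × K × T))
    (F : Subgroup (K × L × T)) :
    kappa k D E * kappa k (starProd D E) F = kappa k E F * kappa k D (starProd E F) := by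
  have h := congrArg (Nat.cast : ℕ → k) (card_mul_card_star D E F)
  push_cast at h
  simp only [kappa]
  rw [div_mul_div_comm, div_mul_div_comm, h, mul_comm (Nat.card H : k), mul_comm]

theorem finsupp_induction {ι : Type*} {P : (ι →₀ k) → Prop}
    (hsingle : ∀ i, P (Finsupp.single i 1)) (hadd : ∀ a b, P a → P b → P (a + b))
    (hsmul : ∀ (c : k) a, P a → P (c • a)) (hzero : P 0) (a : ι →₀ k) : P a := by
  induction a using Finsupp.induction_linear with
  | zero => exact hzero
  | add f g hf hg => exact hadd _ _ hf hg
  | single i c =>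
    have h1 : Finsupp.single i c = c • Finsupp.single i (1 : k) := by simp
    rw [h1]
    exact hsmul c _ (hsingle i)

theorem starComp_assoc (a : Subgroup (G × H × T) →₀ k) (b : Subgroup (H × K × T) →₀ k)
    (c : Subgroup (K × L × T) →₀ k) :
    starComp k (starComp k a b) c = starComp k a (starComp k b c) := by
  induction a using finsupp_induction with
  | hadd a a' h h' => simp only [map_add, LinearMap.add_apply, h, h']
  | hsmul r a h => simp only [map_smul, LinearMap.smul_apply, h]
  | hzero => simp only [map_zero, LinearMap.zero_apply]
  | hsingle D =>
  induction b using finsupp_induction with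
  | hadd a a' h h' => simp only [map_add, LinearMap.add_apply, h, h']
  | hsmul r a h => simp only [map_smul, LinearMap.smul_apply, h]
  | hzero => simp only [map_zero, LinearMap.zero_apply]
  | hsingle E =>
  induction c using finsupp_induction with
  | hadd a a' h h' => simp only [map_add, h, h']
  | hsmul r a h => simp only [map_smul, h]
  | hzero => simp only [map_zero]
  | hsingle F =>
  rw [starComp_single, starComp_single, map_smul, map_smul, LinearMap.smul_apply,
    starComp_single, starComp_single, smul_smul, smul_smul, kappa_cocycle, starProd_assoc]

theorem diag_starComp [CharZero k] [Finite G] (a : Subgroup (G × H × T) →₀ k) :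
    starComp k ((Nat.card G : k) • Finsupp.single (diagSubgroup G T) 1) a = a := by
  induction a using finsupp_induction with
  | hadd a a' h h' => simp only [map_add, h, h']
  | hsmul r a h => rw [map_smul, h]
  | hzero => simp only [map_zero]
  | hsingle D =>
  have h1 : kTwo (diagSubgroup G T) ⊓ kOne D = ⊥ := by
    rw [eq_bot_iff]
    rintro x ⟨hx, -⟩
    exact (show (1 : G) = x from hx).symm
  rw [map_smul, LinearMap.smul_apply, starComp_single, diag_starProd, smul_smul, kappa, h1,
    Subgroup.card_bot, Nat.cast_one, mul_one_div_cancel (Nat.cast_ne_zero.2 Nat.card_pos.ne'),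
    one_smul]

theorem starComp_diag [CharZero k] [Finite H] (a : Subgroup (G × H × T) →₀ k) :
    starComp k a ((Nat.card H : k) • Finsupp.single (diagSubgroup H T) 1) = a := by
  induction a using finsupp_induction with
  | hadd a a' h h' => simp only [map_add, LinearMap.add_apply, h, h']
  | hsmul r a h => rw [LinearMap.map_smul₂, h]
  | hzero => simp only [map_zero, LinearMap.zero_apply]
  | hsingle D =>
  have h1 : kTwo D ⊓ kOne (diagSubgroup H T) = ⊥ := by
    rw [eq_bot_iff]
    rintro x ⟨-, hx⟩
    exact (show x = 1 from hx)
  rw [map_smul, starComp_single, starProd_diag, smul_smul, kappa, h1,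
    Subgroup.card_bot, Nat.cast_one, mul_one_div_cancel (Nat.cast_ne_zero.2 Nat.card_pos.ne'),
    one_smul]

end Star

section EssentialStar

variable (k : Type v) [Field k] (T G : Type u) [Group T] [Group G]

/-- The `k`-vector space `k𝒮_{GGT}`, to be equipped with the product `∗_G^κ`. -/
def StarAlgebra : Type (max u v) := Subgroup (G × G × T) →₀ k

noncomputable instance : AddCommGroup (StarAlgebra k T G) :=
  inferInstanceAs (AddCommGroup (Subgroup (G × G × T) →₀ k))

noncomputable instance : Module k (StarAlgebra k T G) :=
  inferInstanceAs (Module k (Subgroup (G × G × T) →₀ k))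

/-- The ring `(k𝒮_{GGT}, ∗_G^κ)`, with identity element `|G| (Δ(G) × T)`. -/
noncomputable instance [CharZero k] [Finite G] : Ring (StarAlgebra k T G) :=
  { (inferInstance : AddCommGroup (StarAlgebra k T G)) with
    mul := fun a b => starComp k (G := G) (H := G) (K := G) (T := T) a b
    one := (Nat.card G : k) • (Finsupp.single (diagSubgroup G T) 1 : Subgroup (G × G × T) →₀ k)
    mul_assoc := starComp_assoc k
    one_mul := diag_starComp k
    mul_one := starComp_diag k
    left_distrib := fun a => map_add (starComp k (G := G) (H := G) (K := G) (T := T) a)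
    right_distrib := LinearMap.map_add₂ (starComp k (G := G) (H := G) (K := G) (T := T))
    zero_mul := LinearMap.map_zero₂ (starComp k (G := G) (H := G) (K := G) (T := T))
    mul_zero := fun a => map_zero (starComp k (G := G) (H := G) (K := G) (T := T) a) }

noncomputable instance [CharZero k] [Finite G] : Algebra k (StarAlgebra k T G) :=
  Algebra.ofModule
    (fun c a b => LinearMap.map_smul₂ (starComp k (G := G) (H := G) (K := G) (T := T)) c a b)
    (fun c a b => map_smul (starComp k (G := G) (H := G) (K := G) (T := T) a) c b)

/-- The two-sided ideal `J` of `k𝒮_{GGT}` generated by the elements `a ∗_K^κ b` with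
`a ∈ k𝒮_{GKT}`, `b ∈ k𝒮_{KGT}` and `K` a group with `|K| < |G|`. -/
noncomputable def starIdeal [CharZero k] [Finite G] : Ideal (StarAlgebra k T G) :=
  (TwoSidedIdeal.span {z : StarAlgebra k T G |
    ∃ (K : Type u) (_ : Group K) (_ : Finite K), Nat.card K < Nat.card G ∧
      ∃ (a : Subgroup (G × K × T) →₀ k) (b : Subgroup (K × G × T) →₀ k),
        z = starComp k a b}).asIdeal

instance [CharZero k] [Finite G] : (starIdeal k T G).IsTwoSided :=
  inferInstanceAs (TwoSidedIdeal.asIdeal _).IsTwoSided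

/-- The essential star algebra. -/
abbrev EssentialStar [CharZero k] [Finite G] : Type (max u v) :=
  StarAlgebra k T G ⧸ starIdeal k T G

/-- The natural epimorphism from `k𝒮_{GGT}` onto the essential star algebra. -/
noncomputable def essentialStarMk [CharZero k] [Finite G] :
    StarAlgebra k T G →ₐ[k] EssentialStar k T G :=
  Ideal.Quotient.mkₐ k (starIdeal k T G)

end EssentialStar

/-! ### The map `α` and the set `ℒ_{s'}` -/

section Alpha

variable (k : Type v) [Field k]

/-- The `k`-linear map `α` from `kB(Γ)` to the `k`-vector space with basis the subgroups of `Γ`,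
`[X] ↦ ∑_{x ∈ X} Stab_Γ(x)`. -/
noncomputable def alpha (Γ : Type u) [Group Γ] : Burnside k Γ →ₗ[k] (Subgroup Γ →₀ k) :=
  Burnside.lift k
    (fun X =>
      letI := Fintype.ofFinite X.carrier
      ∑ x : X.carrier, Finsupp.single (MulAction.stabilizer Γ x) 1)
    (by
      rintro X Y ⟨e, he⟩
      let _ := Fintype.ofFinite X.carrier
      let _ := Fintype.ofFinite Y.carrier
      refine Fintype.sum_equiv e _ _ fun x => congrArg (Finsupp.single · 1) ?_
      ext g
      rw [MulAction.mem_stabilizer_iff, MulAction.mem_stabilizer_iff, ← he,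
        EmbeddingLike.apply_eq_iff_eq])
    (by
      intro X Y
      let _ := Fintype.ofFinite X.carrier
      let _ := Fintype.ofFinite Y.carrier
      let _ := Fintype.ofFinite (X.disjUnion Y).carrier
      let e : (X.disjUnion Y).carrier ≃ X.carrier ⊕ Y.carrier := Equiv.refl _
      refine Eq.trans (Fintype.sum_equiv e _ (Sum.elim
        (fun x => Finsupp.single (MulAction.stabilizer Γ x) 1)
        (fun y => Finsupp.single (MulAction.stabilizer Γ y) 1)) ?_) (Fintype.sum_sum_type _)
      rintro (x | y)
      · refine congrArg (Finsupp.single · 1) ?_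
        ext g
        exact Sum.inl_injective.eq_iff
      · refine congrArg (Finsupp.single · 1) ?_
        ext g
        exact Sum.inr_injective.eq_iff)

/-- The map `α_{GGT} : kB_T(G × G) → k𝒮_{GGT}`. -/
noncomputable def alphaGGT (T G : Type u) [Group T] [Group G] :
    BurnsideEnd k T G →ₗ[k] StarAlgebra k T G :=
  alpha k (G × G × T)

end Alpha

section Ls

variable {T G : Type u} [Group T] [Group G]

/-- `D = E ∗ F` for some `E ≤ G × H × T`, `F ≤ H × G × T` and a group `H` with `|H| < |G|`. -/
def IsStarDecomposable (D : Subgroup (G × G × T)) : Prop :=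
  ∃ (H : Type u) (_ : Group H) (_ : Finite H), Nat.card H < Nat.card G ∧
    ∃ (E : Subgroup (G × H × T)) (F : Subgroup (H × G × T)), D = starProd E F

/-- The class `[GGT / D]` in `kB_T(G × G)`. -/
noncomputable def transitiveClass (k : Type v) [CommRing k] [Finite G] [Finite T]
    (D : Subgroup (G × G × T)) : BurnsideEnd k T G :=
  cls k (FinGSet.coset D)

/-- The set `ℒ_{s'}` of the images in the essential algebra of the classes `[GGT / D]` such that
`D` is not a star product through a group of order smaller than `|G|`. -/
def Ls (k : Type v) [CommRing k] (T G : Type u) [Group T] [Group G] [Finite G] [Finite T] :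
    Set (EssentialBurnside k T G) :=
  {z | ∃ D : Subgroup (G × G × T), ¬ IsStarDecomposable D ∧
    z = essentialMk k T G (transitiveClass k D)}

end Ls

end ShiftedBurnside

/-! The algebra isomorphism already exists before passing to quotients. Write `Γ = G × G × T`.

Multiplicativity of `α` is orbit counting and needs no commutativity. The fibre of `X × Y → X ×_H^d
Y` over `[x, y]` is an `H`-orbit, and the stabilizer of `(x, y)` in `H` is `k₂ ∩ k₁` of the two
point stabilizers. So `κ` is the inverse of the fibre's cardinality, while the stabilizer of `[x,
y]` is the star product of the stabilizers of `x` and `y` (`alpha_tensor`).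

Bijectivity uses that `Γ` is abelian. Every point of `Γ / D` has stabilizer `D`, so `α [Γ / D] = |Γ
: D| D`, a nonzero multiple of a basis vector in characteristic `0`, and the classes `[Γ / D]` span
(`span_cls_coset`).

It remains to match the ideals. Let `W` be the span of the star decomposable subgroups. The image of
the Burnside ideal lies in the star ideal because `α` is multiplicative, and the star ideal lies in
`W` because `W` is a two-sided ideal containing its generators. To close the circle, each
decomposable `E ∗ F` must come from the Burnside ideal. The difficulty is that `E` and `F` need not
lie in the image of `α` when the intermediate group is nonabelian. `exists_comm_starProd` replaces
that group by an abelian one that is no larger, where `α` is invertible. Thus all three coincide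
(`mem_burnsideIdeal_iff`). The quotient by `W` has the indecomposable subgroups as a basis, which
gives `ℒ_{s'}`. -/

namespace ShiftedBurnside

/-! ### Multiplicativity of `α`, for arbitrary groups -/

section AlphaComp

variable {G H K T : Type u} [Group G] [Group H] [Group K] [Group T]

theorem stabilizer_tmk {X : FinGSet (G × H × T)} {Y : FinGSet (H × K × T)} (x : X.carrier)
    (y : Y.carrier) :
    MulAction.stabilizer (G × K × T) (tmk x y : (X.tensor Y).carrier) =
      starProd (MulAction.stabilizer (G × H × T) x) (MulAction.stabilizer (H × K × T) y) := by
  ext ⟨g, l, t⟩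
  rw [MulAction.mem_stabilizer_iff, smul_tmk, tmk_eq_iff, mem_starProd]
  simp only [MulAction.mem_stabilizer_iff, smul_smul, Prod.mk_mul_mk, one_mul, mul_one]
  exact exists_congr fun h => and_congr eq_comm eq_comm

/-- The action of `H` on `X × Y` whose orbits are the elements of `X ×_H^d Y`. -/
abbrev tensorAction (X : FinGSet (G × H × T)) (Y : FinGSet (H × K × T)) :
    MulAction H (X.carrier × Y.carrier) where
  smul h p := (((1, h, 1) : G × H × T) • p.1, ((h, 1, 1) : H × K × T) • p.2)
  one_smul p := Prod.ext (one_smul (G × H × T) p.1) (one_smul (H × K × T) p.2)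
  mul_smul h h' p := Prod.ext
    (by
      change ((1, h * h', 1) : G × H × T) • p.1 = ((1, h, 1) : G × H × T) • (1, h', 1) • p.1
      simp [smul_smul])
    (by
      change ((h * h', 1, 1) : H × K × T) • p.2 = ((h, 1, 1) : H × K × T) • (h', 1, 1) • p.2
      simp [smul_smul])

/-- This is the orbit-stabilizer theorem for `tensorAction`. It identifies `κ` as the reciprocal of
the fibre size. -/
theorem card_fiber_mul_card (X : FinGSet (G × H × T)) (Y : FinGSet (H × K × T))
    (x : X.carrier) (y : Y.carrier) :
    Nat.card {p : X.carrier × Y.carrier // (tmk p.1 p.2 : (X.tensor Y).carrier) = tmk x y} *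
      Nat.card ↥(kTwo (MulAction.stabilizer (G × H × T) x) ⊓
        kOne (MulAction.stabilizer (H × K × T) y)) = Nat.card H := by
  let _ := tensorAction X Y
  have h1 : kTwo (MulAction.stabilizer (G × H × T) x) ⊓
      kOne (MulAction.stabilizer (H × K × T) y) = MulAction.stabilizer H (x, y) := by
    ext h
    exact (Prod.ext_iff (x := ((1, h, 1) • x, (h, 1, 1) • y)) (y := (x, y))).symm
  have h2 : ∀ p : X.carrier × Y.carrier,
      (tmk p.1 p.2 : (X.tensor Y).carrier) = tmk x y ↔ p ∈ MulAction.orbit H (x, y) := by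
    intro p
    rw [eq_comm, tmk_eq_iff]
    exact exists_congr fun h => by
      rw [eq_comm, eq_comm (a := p.2)]
      exact (Prod.ext_iff (x := ((1, h, 1) • x, (h, 1, 1) • y)) (y := p)).symm
  rw [h1, Nat.card_congr (Equiv.subtypeEquivRight h2), ← Nat.card_prod]
  exact Nat.card_congr (MulAction.orbitProdStabilizerEquivGroup H (x, y))

variable (k : Type v) [Field k]

theorem alpha_cls {Γ : Type u} [Group Γ] (X : FinGSet Γ) [Fintype X.carrier] :
    alpha k Γ (cls k X) =
      ∑ x : X.carrier, Finsupp.single (MulAction.stabilizer Γ x) 1 := by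
  rw [alpha, Burnside.lift_cls]
  congr!

/-- The product on the right is a sum over `X × Y`. Grouped along the fibres of `(x, y) ↦ [x, y]`,
it is constant on each fibre, where `n` terms carry the coefficient `n⁻¹` and so leave the
stabilizer of `[x, y]` with coefficient `1`. -/
theorem alpha_tensor [CharZero k] [Finite H] (X : FinGSet (G × H × T))
    (Y : FinGSet (H × K × T)) :
    alpha k _ (cls k (X.tensor Y)) = starComp k (alpha k _ (cls k X)) (alpha k _ (cls k Y)) := by
  classical
  let _ := Fintype.ofFinite X.carrier
  let _ := Fintype.ofFinite Y.carrier
  let _ := Fintype.ofFinite (X.tensor Y).carrier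
  rw [alpha_cls, alpha_cls, alpha_cls]
  simp only [map_sum, LinearMap.sum_apply, starComp_single]
  rw [Finset.sum_comm]
  rw [← Fintype.sum_prod_type', ← Finset.sum_fiberwise (s := Finset.univ)
    (g := fun p : X.carrier × Y.carrier => (tmk p.1 p.2 : (X.tensor Y).carrier))]
  refine Finset.sum_congr rfl ?_
  refine tmk_ind fun x y _ => ?_
  have h : ∀ p ∈ Finset.univ.filter fun p : X.carrier × Y.carrier =>
      (tmk p.1 p.2 : (X.tensor Y).carrier) = tmk x y,
      kappa k (MulAction.stabilizer (G × H × T) p.1) (MulAction.stabilizer (H × K × T) p.2) •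
        Finsupp.single (starProd (MulAction.stabilizer (G × H × T) p.1)
          (MulAction.stabilizer (H × K × T) p.2)) (1 : k) =
      ((Finset.univ.filter fun p : X.carrier × Y.carrier =>
        (tmk p.1 p.2 : (X.tensor Y).carrier) = tmk x y).card : k)⁻¹ •
        Finsupp.single (MulAction.stabilizer (G × K × T) (tmk x y : (X.tensor Y).carrier)) 1 := by
    intro p hp
    have hp := (Finset.mem_filter.1 hp).2
    have hc := card_fiber_mul_card X Y p.1 p.2
    rw [hp, Nat.card_eq_fintype_card, Fintype.card_subtype] at hc
    rw [← stabilizer_tmk, hp, kappa, ← hc, Nat.cast_mul, div_mul_cancel_right₀]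
    intro h0
    rw [Nat.cast_eq_zero] at h0
    rw [h0, mul_zero] at hc
    exact Nat.card_pos.ne hc
  rw [Finset.sum_congr rfl h, Finset.sum_const, ← Nat.cast_smul_eq_nsmul k, smul_smul,
    mul_inv_cancel₀, one_smul]
  rw [Nat.cast_ne_zero, Finset.card_ne_zero]
  exact ⟨(x, y), by simp⟩

theorem alpha_burnsideComp [CharZero k] [Finite H] (a : Burnside k (G × H × T))
    (b : Burnside k (H × K × T)) :
    alpha k _ (burnsideComp k a b) = starComp k (alpha k _ a) (alpha k _ b) := by
  induction a using Burnside.induction with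
  | hadd a a' h h' => simp only [map_add, LinearMap.add_apply, h, h']
  | hsmul r a h => simp only [map_smul, LinearMap.smul_apply, h]
  | hcls X =>
  induction b using Burnside.induction with
  | hadd a a' h h' => simp only [map_add, h, h']
  | hsmul r a h => simp only [map_smul, h]
  | hcls Y => rw [burnsideComp_cls, alpha_tensor]

end AlphaComp

/-! ### Transitive sets span the Burnside module -/

section Transitive

variable {Γ : Type u} [Group Γ]

/-- The `Γ`-set on an invariant subset of a finite `Γ`-set. -/
def FinGSet.ofSub (X : FinGSet Γ) (S : SubMulAction Γ X.carrier) : FinGSet Γ := ⟨S⟩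

/-- For empty `X`, `X ⊔ X ≅ X`, whence `[X] + [X] = [X]`. -/
theorem cls_eq_zero_of_isEmpty (k : Type v) [CommRing k] (X : FinGSet Γ) [IsEmpty X.carrier] :
    cls k X = 0 := by
  have h : (X.disjUnion X).Iso X :=
    haveI : IsEmpty (X.disjUnion X).carrier := inferInstanceAs (IsEmpty (X.carrier ⊕ X.carrier))
    ⟨Equiv.equivOfIsEmpty _ _, fun _ x => isEmptyElim x⟩
  have h1 := cls_iso k h
  rw [cls_disjUnion] at h1
  exact add_eq_left.1 h1

theorem disjUnion_ofSub_iso (X : FinGSet Γ) (S S' : SubMulAction Γ X.carrier)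
    (h : ∀ x, x ∈ S' ↔ x ∉ S) : ((X.ofSub S).disjUnion (X.ofSub S')).Iso X := by
  classical
  refine ⟨(Equiv.sumCongr (Equiv.refl S) (Equiv.subtypeEquivRight h)).trans
    (Equiv.sumCompl (· ∈ S)), ?_⟩
  rintro g (x | x) <;> rfl

/-- The classes of the transitive `Γ`-sets span `kB(Γ)`. -/
theorem span_cls_coset [Finite Γ] (k : Type v) [CommRing k] :
    Submodule.span k (Set.range fun D : Subgroup Γ => cls k (FinGSet.coset D)) = ⊤ := by
  have key : ∀ (n : ℕ) (X : FinGSet Γ), Nat.card X.carrier = n →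
      cls k X ∈ Submodule.span k (Set.range fun D : Subgroup Γ => cls k (FinGSet.coset D)) := by
    intro n
    induction n using Nat.strong_induction_on with
    | _ n ih =>
    rintro X rfl
    rcases isEmpty_or_nonempty X.carrier with hX | ⟨⟨x⟩⟩
    · rw [cls_eq_zero_of_isEmpty]
      exact zero_mem _
    -- Split off the orbit of `x`, which is a transitive set. The complement misses `x`, so the
    -- induction hypothesis on cardinality applies to it.
    let S : SubMulAction Γ X.carrier :=
      { carrier := MulAction.orbit Γ x
        smul_mem' := fun g y hy => MulAction.mem_orbit_of_mem_orbit g hy }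
    let S' : SubMulAction Γ X.carrier :=
      { carrier := (MulAction.orbit Γ x)ᶜ
        smul_mem' := fun g y hy h => hy <| by
          simpa using MulAction.mem_orbit_of_mem_orbit g⁻¹ h }
    rw [← cls_iso k (disjUnion_ofSub_iso X S S' fun _ => Iff.rfl), cls_disjUnion]
    refine add_mem ?_ (ih _ ?_ _ rfl)
    · have hS : (X.ofSub S).Iso (FinGSet.coset (MulAction.stabilizer Γ x)) := by
        let e := MulAction.orbitEquivQuotientStabilizer Γ x
        have he : ∀ (g : Γ) q, e.symm (g • q) = g • e.symm q := by
          intro g q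
          induction q using QuotientGroup.induction_on with
          | H a =>
          refine Subtype.ext ?_
          rw [MulAction.orbit.coe_smul, MulAction.Quotient.smul_coe,
            MulAction.orbitEquivQuotientStabilizer_symm_apply,
            MulAction.orbitEquivQuotientStabilizer_symm_apply, smul_eq_mul, mul_smul]
        refine ⟨e, fun g y => e.symm.injective ?_⟩
        exact (e.symm_apply_apply _).trans
          ((he g (e y)).trans (congrArg (g • ·) (e.symm_apply_apply y))).symm
      rw [cls_iso k hS]
      exact Submodule.subset_span ⟨_, rfl⟩
    · exact Finite.card_subtype_lt (p := (· ∈ S')) (x := x)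
        fun h => h (MulAction.mem_orbit_self x)
  rw [eq_top_iff]
  rintro a -
  induction a using Burnside.induction with
  | hadd a a' h h' => exact add_mem h h'
  | hsmul r a h => exact Submodule.smul_mem _ r h
  | hcls X => exact key _ X rfl

end Transitive

/-! ### Bijectivity of `α` for abelian groups -/

section CommAlpha

variable {Γ : Type u} [CommGroup Γ] [Finite Γ]

/-- The stabilizer of `gD` is the conjugate of `D` by `g`, which is `D` itself here, and there are
`|Γ : D|` cosets. -/
theorem alpha_cls_coset (k : Type v) [Field k] (D : Subgroup Γ) :
    alpha k Γ (cls k (FinGSet.coset D)) = (D.index : k) • Finsupp.single D 1 := by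
  let _ := Fintype.ofFinite (FinGSet.coset D).carrier
  have h : ∀ x : (FinGSet.coset D).carrier, MulAction.stabilizer Γ x = D := by
    intro x
    change MulAction.stabilizer Γ (show Γ ⧸ D from x) = D
    induction x using QuotientGroup.induction_on with
    | H g =>
    ext h
    rw [MulAction.mem_stabilizer_iff, MulAction.Quotient.smul_coe, smul_eq_mul, eq_comm,
      QuotientGroup.eq, mul_comm h, inv_mul_cancel_left]
  rw [alpha_cls]
  simp only [h]
  rw [Finset.sum_const, ← Nat.cast_smul_eq_nsmul k, Finset.card_univ,
    ← Nat.card_eq_fintype_card]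
  rfl

variable (k : Type v) [Field k]

theorem index_cast_ne_zero [CharZero k] (D : Subgroup Γ) : (D.index : k) ≠ 0 :=
  Nat.cast_ne_zero.2 Subgroup.index_ne_zero_of_finite

/-- The inverse `D ↦ |Γ / D|⁻¹ [Γ / D]` of `α` for abelian `Γ`. -/
noncomputable def alphaInv (Γ : Type u) [CommGroup Γ] [Finite Γ] :
    (Subgroup Γ →₀ k) →ₗ[k] Burnside k Γ :=
  Finsupp.linearCombination k fun D => (D.index : k)⁻¹ • cls k (FinGSet.coset D)

theorem alphaInv_single (D : Subgroup Γ) :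
    alphaInv k Γ (Finsupp.single D 1) = (D.index : k)⁻¹ • cls k (FinGSet.coset D) := by
  simp [alphaInv]

theorem alpha_alphaInv [CharZero k] (a : Subgroup Γ →₀ k) : alpha k Γ (alphaInv k Γ a) = a := by
  induction a using finsupp_induction with
  | hadd a a' h h' => rw [map_add, map_add, h, h']
  | hsmul r a h => rw [map_smul, map_smul, h]
  | hzero => rw [map_zero, map_zero]
  | hsingle D =>
  rw [alphaInv_single, map_smul, alpha_cls_coset, smul_smul,
    inv_mul_cancel₀ (index_cast_ne_zero k D), one_smul]

/-- It is enough to check the classes `[Γ / D]`, since they span. Their linear independence is a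
consequence rather than an ingredient. -/
theorem alphaInv_alpha [CharZero k] (a : Burnside k Γ) : alphaInv k Γ (alpha k Γ a) = a := by
  have h : a ∈ Submodule.span k (Set.range fun D : Subgroup Γ => cls k (FinGSet.coset D)) := by
    rw [span_cls_coset]
    trivial
  induction h using Submodule.span_induction with
  | mem x hx =>
    obtain ⟨D, rfl⟩ := hx
    rw [alpha_cls_coset, map_smul, alphaInv_single, smul_smul,
      mul_inv_cancel₀ (index_cast_ne_zero k D), one_smul]
  | zero => rw [map_zero, map_zero]
  | add x y _ _ hx hy => rw [map_add, map_add, hx, hy]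
  | smul c x _ hx => rw [map_smul, map_smul, hx]

end CommAlpha

/-! ### Making the intermediate group abelian -/

section Abelianize

variable {G H K T : Type u} [CommGroup G] [Group H] [Group K] [CommGroup T]

/-- For abelian `G` and `T`, a star product through `H` is also a star product through an abelian
group that is a quotient of a subgroup of `H`. -/
theorem exists_comm_starProd [Finite H] (D : Subgroup (G × H × T)) (E : Subgroup (H × K × T)) :
    ∃ (A : Type u) (_ : CommGroup A) (_ : Finite A), Nat.card A ≤ Nat.card H ∧
      ∃ (D' : Subgroup (G × A × T)) (E' : Subgroup (A × K × T)),
        starProd D' E' = starProd D E := by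
  -- Only elements of the projection `M` of `D` to `H` can occur as middle terms of `D ∗ E`. The
  -- abelian group sought is the abelianization of `M`.
  let M : Subgroup H := D.map ((MonoidHom.fst H T).comp (MonoidHom.snd G (H × T)))
  let q : M →* Abelianization M := Abelianization.of
  have hq : ∀ x y : M, q x = q y → (1, (x⁻¹ * y : M).1, 1) ∈ D := by
    intro x y hxy
    have h1 : x⁻¹ * y ∈ commutator M := QuotientGroup.eq.1 hxy
    -- Lift two elements of `M` to `D`. The commutator of the lifts has trivial components in the
    -- abelian groups `G` and `T`, so the commutator in `M` lies in `k₂(D)`.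
    have h2 : commutator M ≤ (kTwo D).comap M.subtype := by
      rw [commutator_def, Subgroup.commutator_le]
      rintro ⟨_, ⟨⟨g, a, t⟩, ha, rfl⟩⟩ - ⟨_, ⟨⟨g', b, t'⟩, hb, rfl⟩⟩ -
      have h3 := D.mul_mem (D.mul_mem (D.mul_mem ha hb) (D.inv_mem ha)) (D.inv_mem hb)
      rw [Subgroup.mem_comap, mem_kTwo]
      convert! h3 using 1
      refine Prod.ext ?_ (Prod.ext rfl ?_)
      · change (1 : G) = g * g' * g⁻¹ * g'⁻¹
        rw [mul_inv_cancel_comm, mul_inv_cancel]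
      · change (1 : T) = t * t' * t⁻¹ * t'⁻¹
        rw [mul_inv_cancel_comm, mul_inv_cancel]
    exact h2 h1
  have : Finite (Abelianization M) := Quotient.finite _
  refine ⟨Abelianization M, inferInstance, this, ?_, ?_⟩
  · exact (Nat.card_le_card_of_surjective q Quotient.mk_surjective).trans
      (Nat.card_le_card_of_injective _ M.subtype_injective)
  -- `D'` is the image of `D` modulo commutators of `M`, and `E'` is the image of the part of `E`
  -- with first coordinate in `M`.
  let D' : Subgroup (G × Abelianization M × T) :=
    { carrier := {a | ∃ x : M, q x = a.2.1 ∧ (a.1, x.1, a.2.2) ∈ D}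
      one_mem' := ⟨1, map_one q, D.one_mem⟩
      mul_mem' := by
        rintro a b ⟨x, h1, h2⟩ ⟨y, h3, h4⟩
        exact ⟨x * y, by rw [map_mul, h1, h3]; rfl, D.mul_mem h2 h4⟩
      inv_mem' := by
        rintro a ⟨x, h1, h2⟩
        exact ⟨x⁻¹, by rw [map_inv, h1]; rfl, D.inv_mem h2⟩ }
  let E' : Subgroup (Abelianization M × K × T) :=
    { carrier := {a | ∃ x : M, q x = a.1 ∧ (x.1, a.2.1, a.2.2) ∈ E}
      one_mem' := ⟨1, map_one q, E.one_mem⟩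
      mul_mem' := by
        rintro a b ⟨x, h1, h2⟩ ⟨y, h3, h4⟩
        exact ⟨x * y, by rw [map_mul, h1, h3]; rfl, E.mul_mem h2 h4⟩
      inv_mem' := by
        rintro a ⟨x, h1, h2⟩
        exact ⟨x⁻¹, by rw [map_inv, h1]; rfl, E.inv_mem h2⟩ }
  refine ⟨D', E', ?_⟩
  ext ⟨g, l, t⟩
  rw [mem_starProd, mem_starProd]
  constructor
  · rintro ⟨a, ⟨x, hx, hD⟩, ⟨y, hy, hE⟩⟩
    -- The lifts `x` and `y` of `a` may differ. The one from `E` is kept, because `D` is stable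
    -- under multiplication by `x⁻¹ * y` in its middle coordinate.
    refine ⟨y.1, ?_, hE⟩
    have h := D.mul_mem hD (hq x y (hx.trans hy.symm))
    simpa using h
  · rintro ⟨x, hD, hE⟩
    let x' : M := ⟨x, (g, x, t), hD, rfl⟩
    exact ⟨q x', ⟨x', rfl, hD⟩, ⟨x', rfl, hE⟩⟩

end Abelianize

/-! ### The span of the decomposable subgroups as an ideal -/

section Ideals

theorem span_asIdeal_le {R : Type*} [Ring R] {s : Set R} {I : Ideal R} [I.IsTwoSided]
    (h : s ⊆ I) : (TwoSidedIdeal.span s).asIdeal ≤ I := by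
  intro x hx
  have h1 : TwoSidedIdeal.span s ≤ I.toTwoSided := TwoSidedIdeal.span_le.2 (by simpa using h)
  exact Ideal.mem_toTwoSided.1 (h1 hx)

/-- This makes it possible to divide by `κ` and recover `E ∗ F` from the product of `E` and `F`. -/
theorem kappa_ne_zero (k : Type v) [Field k] [CharZero k] {G H K T : Type u} [Group G] [Group H]
    [Group K] [Group T] [Finite H] (D : Subgroup (G × H × T)) (E : Subgroup (H × K × T)) :
    kappa k D E ≠ 0 :=
  div_ne_zero (Nat.cast_ne_zero.2 Nat.card_pos.ne') (Nat.cast_ne_zero.2 Nat.card_pos.ne')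

section

variable {G T : Type u} [Group G] [Group T]

/-- By associativity the extra factor is absorbed into the outer factor of the decomposition. This
and its mirror image make `decomposableSpan` a two-sided ideal. -/
theorem IsStarDecomposable.starProd_left {D : Subgroup (G × G × T)} (h : IsStarDecomposable D)
    (E : Subgroup (G × G × T)) : IsStarDecomposable (starProd E D) := by
  obtain ⟨H, hH, hf, hlt, A, B, rfl⟩ := h
  exact ⟨H, hH, hf, hlt, starProd E A, B, (starProd_assoc E A B).symm⟩

theorem IsStarDecomposable.starProd_right {D : Subgroup (G × G × T)} (h : IsStarDecomposable D)
    (E : Subgroup (G × G × T)) : IsStarDecomposable (starProd D E) := by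
  obtain ⟨H, hH, hf, hlt, A, B, rfl⟩ := h
  exact ⟨H, hH, hf, hlt, A, starProd B E, starProd_assoc A B E⟩

end

variable (k : Type v) [Field k] (T G : Type u)

/-- The span of the star decomposable subgroups. -/
noncomputable def decomposableSpan [Group T] [Group G] : Submodule k (Subgroup (G × G × T) →₀ k) :=
  Finsupp.supported k k {D | IsStarDecomposable D}

theorem single_mem_decomposableSpan [Group T] [Group G] {D : Subgroup (G × G × T)}
    (h : IsStarDecomposable D) : Finsupp.single D 1 ∈ decomposableSpan k T G :=
  Finsupp.single_mem_supported k 1 h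

theorem decomposableSpan_induction [Group T] [Group G]
    {P : ∀ a : Subgroup (G × G × T) →₀ k, a ∈ decomposableSpan k T G → Prop}
    (hsingle : ∀ D (hD : IsStarDecomposable D), P (Finsupp.single D 1)
      (single_mem_decomposableSpan k T G hD))
    (hadd : ∀ a b ha hb, P a ha → P b hb → P (a + b) (add_mem ha hb))
    (hsmul : ∀ (c : k) a ha, P a ha → P (c • a) (Submodule.smul_mem _ c ha))
    (hzero : P 0 (zero_mem _)) {a : Subgroup (G × G × T) →₀ k}
    (ha : a ∈ decomposableSpan k T G) : P a ha := by
  have h : a ∈ Submodule.span k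
      ((fun D => Finsupp.single D 1) '' {D : Subgroup (G × G × T) | IsStarDecomposable D}) := by
    rwa [decomposableSpan, Finsupp.supported_eq_span_single] at ha
  induction h using Submodule.span_induction with
  | zero => exact hzero
  | add a b h1 h2 h h' =>
    rw [← Finsupp.supported_eq_span_single] at h1 h2
    exact hadd a b h1 h2 (h h1) (h' h2)
  | smul c a h1 h =>
    rw [← Finsupp.supported_eq_span_single] at h1
    exact hsmul c a h1 (h h1)
  | mem a h1 =>
    obtain ⟨D, hD, rfl⟩ := h1
    exact hsingle D hD

theorem starComp_mem_decomposableSpan [Group T] [Group G] {K : Type u} [Group K] [Finite K]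
    (hlt : Nat.card K < Nat.card G) (a : Subgroup (G × K × T) →₀ k)
    (b : Subgroup (K × G × T) →₀ k) : starComp k a b ∈ decomposableSpan k T G := by
  induction a using finsupp_induction with
  | hadd a a' h h' => rw [map_add]; exact add_mem h h'
  | hsmul r a h => rw [map_smul]; exact Submodule.smul_mem _ r h
  | hzero => rw [map_zero]; exact zero_mem _
  | hsingle D =>
  induction b using finsupp_induction with
  | hadd a a' h h' => rw [map_add]; exact add_mem h h'
  | hsmul r a h => rw [map_smul]; exact Submodule.smul_mem _ r h
  | hzero => rw [map_zero]; exact zero_mem _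
  | hsingle E =>
  rw [starComp_single]
  exact Submodule.smul_mem _ _
    (single_mem_decomposableSpan k T G ⟨K, ‹_›, ‹_›, hlt, D, E, rfl⟩)

theorem starComp_mem_decomposableSpan_left [Group T] [Group G] (b : Subgroup (G × G × T) →₀ k)
    {a : Subgroup (G × G × T) →₀ k} (ha : a ∈ decomposableSpan k T G) :
    starComp k b a ∈ decomposableSpan k T G := by
  induction b using finsupp_induction with
  | hadd a a' h h' => rw [map_add]; exact add_mem h h'
  | hsmul r a h => rw [map_smul]; exact Submodule.smul_mem _ r h
  | hzero => rw [map_zero]; exact zero_mem _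
  | hsingle E =>
  induction ha using decomposableSpan_induction with
  | hadd a a' _ _ h h' => rw [map_add]; exact add_mem h h'
  | hsmul r a _ h => rw [map_smul]; exact Submodule.smul_mem _ r h
  | hzero => rw [map_zero]; exact zero_mem _
  | hsingle D hD =>
  rw [starComp_single]
  exact Submodule.smul_mem _ _ (single_mem_decomposableSpan k T G (hD.starProd_left E))

theorem starComp_mem_decomposableSpan_right [Group T] [Group G] (b : Subgroup (G × G × T) →₀ k)
    {a : Subgroup (G × G × T) →₀ k} (ha : a ∈ decomposableSpan k T G) :
    starComp k a b ∈ decomposableSpan k T G := by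
  induction b using finsupp_induction with
  | hadd a a' h h' => rw [map_add]; exact add_mem h h'
  | hsmul r a h => rw [map_smul]; exact Submodule.smul_mem _ r h
  | hzero => rw [map_zero]; exact zero_mem _
  | hsingle E =>
  induction ha using decomposableSpan_induction with
  | hadd a a' _ _ h h' => rw [map_add]; exact add_mem h h'
  | hsmul r a _ h => rw [map_smul]; exact Submodule.smul_mem _ r h
  | hzero => rw [map_zero]; exact zero_mem _
  | hsingle D hD =>
  rw [starComp_single]
  exact Submodule.smul_mem _ _ (single_mem_decomposableSpan k T G (hD.starProd_right E))

theorem mem_decomposableSpan_of_mem_starIdeal [CharZero k] [Group T] [Group G] [Finite G]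
    {a : StarAlgebra k T G} (ha : a ∈ starIdeal k T G) :
    (show Subgroup (G × G × T) →₀ k from a) ∈ decomposableSpan k T G := by
  let W : TwoSidedIdeal (StarAlgebra k T G) :=
    TwoSidedIdeal.mk' (decomposableSpan k T G : Set (Subgroup (G × G × T) →₀ k)) (zero_mem _)
      add_mem neg_mem (starComp_mem_decomposableSpan_left k T G _)
      (starComp_mem_decomposableSpan_right k T G _)
  have hW : ∀ a : StarAlgebra k T G, a ∈ W ↔
      (show Subgroup (G × G × T) →₀ k from a) ∈ decomposableSpan k T G :=
    TwoSidedIdeal.mem_mk' _ _ _ _ _ _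
  refine (hW a).1 (TwoSidedIdeal.span_le.2 ?_ ha)
  rintro _ ⟨K, hK, hf, hlt, a, b, rfl⟩
  exact (hW _).2 (starComp_mem_decomposableSpan k T G hlt a b)

/-- A scalar acts as multiplication by the ring element `c • 1`. -/
theorem smul_mem_burnsideIdeal [Group T] [Group G] [Finite G] (c : k) {a : BurnsideEnd k T G}
    (ha : a ∈ burnsideIdeal k T G) : c • a ∈ burnsideIdeal k T G := by
  have h : (c • (1 : BurnsideEnd k T G)) * a = c • a :=
    (LinearMap.map_smul₂ (burnsideComp k (G := G) (H := G) (K := G) (T := T)) c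
      (1 : BurnsideEnd k T G) a).trans
      (congrArg (c • ·) (one_mul a))
  rw [← h]
  exact Ideal.mul_mem_left _ _ ha

/-! ### Both ideals correspond to the decomposable span -/

variable [CharZero k] [CommGroup G] [Finite G] [CommGroup T] [Finite T]

/-- `α_{GGT}` as an isomorphism of `k`-algebras, for abelian `G` and `T`. -/
noncomputable def alphaAlgEquiv : BurnsideEnd k T G ≃ₐ[k] StarAlgebra k T G :=
  let e : BurnsideEnd k T G ≃ₗ[k] StarAlgebra k T G :=
    LinearEquiv.ofLinearMap (alphaGGT k T G) (alphaInv k (G × G × T))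
      (LinearMap.ext (alpha_alphaInv k)) (LinearMap.ext (alphaInv_alpha k))
  have hmul : ∀ a b, e (a * b) = e a * e b := alpha_burnsideComp k
  AlgEquiv.ofLinearEquiv e
    (by
      -- A surjective multiplicative map preserves the unit, so `α` of the identity biset need not
      -- be computed.
      have h := hmul 1 (e.symm 1)
      rwa [one_mul, e.apply_symm_apply, mul_one, eq_comm] at h)
    hmul

theorem alphaAlgEquiv_apply (a : BurnsideEnd k T G) :
    alphaAlgEquiv k T G a = alphaGGT k T G a := rfl

theorem alphaAlgEquiv_transitiveClass (D : Subgroup (G × G × T)) :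
    alphaAlgEquiv k T G (transitiveClass k D) =
      ((D.index : k) • Finsupp.single D 1 : Subgroup (G × G × T) →₀ k) :=
  alpha_cls_coset k D

/-- `α` sends a generator factoring through `K` to a generator factoring through the same `K`; here
`K` may be nonabelian. -/
theorem burnsideIdeal_le_comap :
    burnsideIdeal k T G ≤ (starIdeal k T G).comap (alphaAlgEquiv k T G) := by
  refine span_asIdeal_le ?_
  rintro _ ⟨K, hK, hf, hlt, a, b, rfl⟩
  exact TwoSidedIdeal.subset_span
    ⟨K, hK, hf, hlt, alpha k _ a, alpha k _ b, alpha_burnsideComp k a b⟩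

theorem alphaInv_starProd_mem_burnsideIdeal {D : Subgroup (G × G × T)}
    (hD : IsStarDecomposable D) :
    (alphaAlgEquiv k T G).symm (Finsupp.single D 1 : Subgroup (G × G × T) →₀ k) ∈
      burnsideIdeal k T G := by
  obtain ⟨K, hK, hf, hlt, E, F, rfl⟩ := hD
  -- `alphaInv` is available only over commutative groups, so the factorization is first moved from
  -- `K` to the abelian `A` with `|A| ≤ |K| < |G|`.
  obtain ⟨A, hA, hAf, hle, E', F', h⟩ := exists_comm_starProd E F
  have h1 : (Finsupp.single (starProd E F) 1 : Subgroup (G × G × T) →₀ k) =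
      (kappa k E' F')⁻¹ • alpha k _ (burnsideComp k (alphaInv k _ (Finsupp.single E' 1))
        (alphaInv k _ (Finsupp.single F' 1))) := by
    rw [alpha_burnsideComp, alpha_alphaInv, alpha_alphaInv, starComp_single, smul_smul,
      inv_mul_cancel₀ (kappa_ne_zero k E' F'), one_smul, h]
  have h2 : (alphaAlgEquiv k T G).symm
      (Finsupp.single (starProd E F) 1 : Subgroup (G × G × T) →₀ k) =
      ((kappa k E' F')⁻¹ • (burnsideComp k (alphaInv k _ (Finsupp.single E' 1))
        (alphaInv k _ (Finsupp.single F' 1)) : Burnside k (G × G × T)) :) := by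
    rw [h1, ← map_smul]
    exact (alphaAlgEquiv k T G).symm_apply_apply _
  rw [h2]
  refine smul_mem_burnsideIdeal k T G _ ?_
  exact TwoSidedIdeal.subset_span ⟨A, inferInstance, hAf, hle.trans_lt hlt, _, _, rfl⟩

theorem symm_mem_burnsideIdeal {a : Subgroup (G × G × T) →₀ k}
    (ha : a ∈ decomposableSpan k T G) :
    (alphaAlgEquiv k T G).symm (show StarAlgebra k T G from a) ∈ burnsideIdeal k T G := by
  induction ha using decomposableSpan_induction with
  | hsingle D hD => exact alphaInv_starProd_mem_burnsideIdeal k T G hD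
  | hadd a b _ _ h h' =>
    exact Set.mem_of_eq_of_mem (map_add (alphaAlgEquiv k T G).symm _ _) (add_mem h h')
  | hsmul c a _ h =>
    exact Set.mem_of_eq_of_mem (map_smul (alphaAlgEquiv k T G).symm c _)
      (smul_mem_burnsideIdeal k T G c h)
  | hzero => exact Set.mem_of_eq_of_mem (map_zero (alphaAlgEquiv k T G).symm) (zero_mem _)

/-- The forward direction passes through the star ideal; the converse is where abelianization
enters. -/
theorem mem_burnsideIdeal_iff (a : BurnsideEnd k T G) :
    a ∈ burnsideIdeal k T G ↔
      (show Subgroup (G × G × T) →₀ k from alphaAlgEquiv k T G a) ∈ decomposableSpan k T G := by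
  refine ⟨fun h => mem_decomposableSpan_of_mem_starIdeal k T G (burnsideIdeal_le_comap k T G h),
    fun h => ?_⟩
  have h2 : (alphaAlgEquiv k T G).symm (alphaAlgEquiv k T G a) ∈ burnsideIdeal k T G :=
    symm_mem_burnsideIdeal k T G h
  rwa [AlgEquiv.symm_apply_apply] at h2

theorem starIdeal_eq_map :
    starIdeal k T G =
      (burnsideIdeal k T G).map (alphaAlgEquiv k T G : BurnsideEnd k T G →+* StarAlgebra k T G) := by
  refine le_antisymm (fun a ha => ?_) (Ideal.map_le_iff_le_comap.2 (burnsideIdeal_le_comap k T G))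
  obtain ⟨b, rfl⟩ := (alphaAlgEquiv k T G).surjective a
  exact Ideal.mem_map_of_mem _
    ((mem_burnsideIdeal_iff k T G b).2 (mem_decomposableSpan_of_mem_starIdeal k T G ha))

end Ideals

/-! ### The basis of the essential algebra -/

section Basis

theorem essentialMk_eq_zero_iff (k : Type v) [CommRing k] (T G : Type u) [Group T] [Group G]
    [Finite G] (a : BurnsideEnd k T G) : essentialMk k T G a = 0 ↔ a ∈ burnsideIdeal k T G :=
  Ideal.Quotient.eq_zero_iff_mem

theorem Ls_eq_range (k : Type v) [CommRing k] (T G : Type u) [Group T] [Group G] [Finite G]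
    [Finite T] :
    Ls k T G = Set.range fun D : {D : Subgroup (G × G × T) // ¬ IsStarDecomposable D} =>
      essentialMk k T G (transitiveClass k D.1) := by
  ext z
  constructor
  · rintro ⟨D, hD, rfl⟩
    exact ⟨⟨D, hD⟩, rfl⟩
  · rintro ⟨D, rfl⟩
    exact ⟨D.1, D.2, rfl⟩

variable (k : Type v) [Field k] [CharZero k] (T G : Type u) [CommGroup G] [Finite G]
  [CommGroup T] [Finite T]

/-- `α` carries the family to nonzero multiples of distinct basis vectors. -/
theorem linearIndependent_transitiveClass :
    LinearIndependent k fun D : {D : Subgroup (G × G × T) // ¬ IsStarDecomposable D} =>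
      transitiveClass k D.1 := by
  refine LinearIndependent.of_comp (alphaAlgEquiv k T G).toLinearMap ?_
  have h : LinearIndependent k fun D : Subgroup (G × G × T) => Finsupp.single D (D.index : k) :=
    Finsupp.linearIndependent_single_of_ne_zero fun D => index_cast_ne_zero k D
  have h1 : (alphaAlgEquiv k T G).toLinearMap ∘
      (fun D : {D : Subgroup (G × G × T) // ¬ IsStarDecomposable D} => transitiveClass k D.1) =
      fun D => (Finsupp.single D.1 (D.1.index : k) : Subgroup (G × G × T) →₀ k) := by
    funext D
    refine (alphaAlgEquiv_transitiveClass k T G D.1).trans ?_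
    rw [Finsupp.smul_single_one]
  rw [h1]
  exact h.comp _ Subtype.val_injective

/-- Independence survives the quotient because the kernel meets the span of the family trivially.
Under `α` the kernel is supported on decomposable subgroups and the span on indecomposable ones. -/
theorem linearIndependent_essentialMk_transitiveClass :
    LinearIndependent k fun D : {D : Subgroup (G × G × T) // ¬ IsStarDecomposable D} =>
      essentialMk k T G (transitiveClass k D.1) := by
  refine (linearIndependent_transitiveClass k T G).map (f := (essentialMk k T G).toLinearMap) ?_
  rw [Submodule.disjoint_def]
  intro a ha h0
  have h1 := (mem_burnsideIdeal_iff k T G a).1 ((essentialMk_eq_zero_iff k T G a).1 h0)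
  have h2 : (show Subgroup (G × G × T) →₀ k from alphaAlgEquiv k T G a) ∈
      Finsupp.supported k k {D | IsStarDecomposable D}ᶜ := by
    have h3 : Submodule.span k (Set.range fun D : {D : Subgroup (G × G × T) //
        ¬ IsStarDecomposable D} => transitiveClass k D.1) ≤
        (Finsupp.supported k k {D : Subgroup (G × G × T) | IsStarDecomposable D}ᶜ).comap
          (alphaGGT k T G) := by
      rw [Submodule.span_le]
      rintro _ ⟨D, rfl⟩
      change alphaGGT k T G (transitiveClass k D.1) ∈ Finsupp.supported k k _
      rw [← alphaAlgEquiv_apply, alphaAlgEquiv_transitiveClass]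
      exact Submodule.smul_mem _ _ (Finsupp.single_mem_supported k 1 D.2)
    exact h3 ha
  have h4 := Submodule.disjoint_def.1
    (Finsupp.disjoint_supported_supported (M := k) (R := k) disjoint_compl_right) _ h1 h2
  exact (map_eq_zero_iff _ (alphaAlgEquiv k T G).injective).1 h4

/-- All classes `[Γ / D]` span, and those with `D` decomposable vanish in the quotient. -/
theorem span_Ls : Submodule.span k (Ls k T G) = ⊤ := by
  rw [eq_top_iff]
  rintro z -
  obtain ⟨a, rfl⟩ := Ideal.Quotient.mk_surjective z
  have h : Submodule.span k (Set.range fun D : Subgroup (G × G × T) => transitiveClass k D) ≤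
      (Submodule.span k (Ls k T G)).comap (essentialMk k T G).toLinearMap := by
    rw [Submodule.span_le]
    rintro _ ⟨D, rfl⟩
    by_cases hD : IsStarDecomposable D
    · have h0 : essentialMk k T G (transitiveClass k D) = 0 := by
        rw [essentialMk_eq_zero_iff, mem_burnsideIdeal_iff, alphaAlgEquiv_transitiveClass]
        exact Submodule.smul_mem _ _ (single_mem_decomposableSpan k T G hD)
      change essentialMk k T G (transitiveClass k D) ∈ Submodule.span k (Ls k T G)
      rw [h0]
      exact zero_mem _
    · exact Submodule.subset_span ⟨D, hD, rfl⟩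
  have ha : a ∈ Submodule.span k
      (Set.range fun D : Subgroup (G × G × T) => transitiveClass k D) := by
    change a ∈ Submodule.span k
      (Set.range fun D : Subgroup (G × G × T) => cls k (FinGSet.coset D))
    rw [span_cls_coset]
    trivial
  exact h ha

end Basis

end ShiftedBurnside

/-! ### The main theorem -/

theorem theorem2 {k : Type v} [Field k] [CharZero k] {G T : Type u} [CommGroup G] [Finite G]
    [CommGroup T] [Finite T] :
    (LinearIndepOn k id (ShiftedBurnside.Ls k T G) ∧
      Submodule.span k (ShiftedBurnside.Ls k T G) = ⊤) ∧
    ∃ φ : ShiftedBurnside.EssentialBurnside k T G ≃ₐ[k] ShiftedBurnside.EssentialStar k T G,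
      ∀ a : ShiftedBurnside.BurnsideEnd k T G,
        φ (ShiftedBurnside.essentialMk k T G a) =
          ShiftedBurnside.essentialStarMk k T G (ShiftedBurnside.alphaGGT k T G a) := by
  refine ⟨⟨?_, ShiftedBurnside.span_Ls k T G⟩,
    Ideal.quotientEquivAlg _ _ (ShiftedBurnside.alphaAlgEquiv k T G)
      (ShiftedBurnside.starIdeal_eq_map k T G), fun a => rfl⟩
  -- Independence of the indexed family also shows that distinct `D` give distinct classes, so it
  -- passes to the set of its values.
  rw [ShiftedBurnside.Ls_eq_range]
  exact (ShiftedBurnside.linearIndependent_essentialMk_transitiveClass k T G).linearIndepOn_id
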